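/- Let $n\ge 1$ and $V_0^n=\{x\in\mathbb R^n: x_1+\cdots+x_n=0\}$. An ordered set partition of a set $J\subseteq\{1,\dots,n\}$ is a sequence $\mathbf S=(S_1,\dots,S_k)$ of nonempty pairwise disjoint blocks with $S_1\cup\cdots\cup S_k=J$. Its plate is the cone $$[\mathbf S]=\Big\{x\in V_0^n:\ x_i=0\text{ for } i\notin J,\ \sum_{i\in S_1\cup\cdots\cup S_j}x_i\ge 0\text{ for } j=1,\dots,k-1\Big\},$$ and $[[\mathbf S]]:V_0^n\to\mathbb C$ is the characteristic function of $[\mathbf S]$. Let $\hat{\mathcal P}^n$ be the complex linear span of the functions $[[\pi]]$, where $\pi$ runs over the ordered set partitions of $\{1,\dots,n\}$. The convolution product of characteristic functions of cones is the characteristic function of their Minkowski sum: $[C_1]\bullet\cdots\bullet[C_l]=[C_1+\cdots+C_l]$. A composite set partition of $\{1,\dots,n\}$ is a set $\{\mathbf S_1,\dots,\mathbf S_l\}$, where $\mathbf S_i$ is an ordered set partition of a nonempty set $J_i$ and $\{J_1,\dots,J_l\}$ is a set partition of $\{1,\dots,n\}$; it is standard if, for each $i$, the first block of $\mathbf S_i$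 contains $\min J_i$. Order the ordered set partitions $(T_1,\dots,T_k)$ of $\{1,\dots,n\}$ by the lexicographic order of their packed words $(c_1,\dots,c_n)$, where $c_i=j-1$ if $i\in T_j$. **Theorem 4.6.** The functions $[[\pi]]$, one for each ordered set partition $\pi$ of $\{1,\dots,n\}$, form a basis of $\hat{\mathcal P}^n$. The convolution products $$[[\mathbf S_1]]\bullet\cdots\bullet[[\mathbf S_l]],$$ one for each standard composite set partition $\{\mathbf S_1,\dots,\mathbf S_l\}$ of $\{1,\dots,n\}$, also form a basis of $\hat{\mathcal P}^n$, the canonical plate basis. Moreover, there is a bijection $\mathcal U$ from the ordered set partitions of $\{1,\dots,n\}$ to the standard composite set partitions such that $\pi$ is the concatenation of the members of $\mathcal U(\pi)$, arranged by decreasing $\min J_i$, and with respect to it the change of basis is unitriangular: the canonical basis element labeled by $\mathcal U(\pi)$ equals $[[\pi]]$ plus a linear combination of functions $[[\pi']]$ with $\pi'$ lexicographically smaller than $\pi$. -/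

import Mathlib

noncomputable section

namespace Plates

/-- The hyperplane `V₀ⁿ = {x ∈ ℝⁿ : x₁ + ⋯ + xₙ = 0}`. The labels `1, …, n` are the elements of
`Fin n`, with their natural order. -/
def V0 (n : ℕ) : Submodule ℝ (Fin n → ℝ) where
  carrier := {x | ∑ i, x i = 0}
  zero_mem' := by simp
  add_mem' := by
    intro x y hx hy
    simp only [Set.mem_ofPred_eq] at hx hy ⊢
    simp [Finset.sum_add_distrib, hx, hy]
  smul_mem' := by
    intro c x hx
    simp only [Set.mem_ofPred_eq] at hx ⊢
    simp [← Finset.mul_sum, hx]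

/-- The characteristic function `[C]` of a subset `C` of `V₀ⁿ`, with values in `ℂ`. -/
def charFn {n : ℕ} (C : Set (V0 n)) : V0 n → ℂ := Set.indicator C 1

/-- The union of the members of a list of sets of labels. -/
def unionOf {n : ℕ} (L : List (Finset (Fin n))) : Finset (Fin n) := L.foldr (· ∪ ·) ∅

/-- An ordered set partition `(S₁, …, S_k)` of some subset `J = S₁ ∪ ⋯ ∪ S_k` of the labels:
a sequence of nonempty pairwise disjoint blocks. -/
@[ext]
structure OrderedSetPartition (n : ℕ) where
  blocks : List (Finset (Fin n))
  nonempty : ∀ B ∈ blocks, B.Nonempty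
  disjoint : blocks.Pairwise Disjoint

/-- The set `J = S₁ ∪ ⋯ ∪ S_k` that is partitioned. -/
def OrderedSetPartition.support {n : ℕ} (S : OrderedSetPartition n) : Finset (Fin n) :=
  unionOf S.blocks

/-- The ordered set partitions of the whole set of labels. -/
def FullOrderedSetPartition (n : ℕ) : Type :=
  {S : OrderedSetPartition n // S.support = Finset.univ}

/-- The plate `[S₁, …, S_k]` of an ordered set partition of `J`: the cone of all `x ∈ V₀ⁿ` with
`x_i = 0` for `i ∉ J` and `∑_{i ∈ S₁ ∪ ⋯ ∪ S_j} x_i ≥ 0` for `j = 1, …, k - 1`. -/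
def OrderedSetPartition.plate {n : ℕ} (S : OrderedSetPartition n) : Set (V0 n) :=
  {x | (∀ i, i ∉ S.support → x.1 i = 0) ∧
    ∀ j : ℕ, 1 ≤ j → j < S.blocks.length → 0 ≤ ∑ i ∈ unionOf (S.blocks.take j), x.1 i}

/-- The linear span, over `ℂ`, of the characteristic functions of all plates labeled by ordered
set partitions of the whole set of labels. -/
def plateSpace (n : ℕ) : Submodule ℂ (V0 n → ℂ) :=
  Submodule.span ℂ (Set.range fun p : FullOrderedSetPartition n => charFn p.1.plate)

/-- A composite set partition: a set of ordered set partitions of nonempty pairwise disjoint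
subsets of the labels which together cover all the labels. -/
@[ext]
structure CompositeSetPartition (n : ℕ) where
  parts : Finset (OrderedSetPartition n)
  nonempty : ∀ S ∈ parts, S.support.Nonempty
  disjoint : (parts : Set (OrderedSetPartition n)).PairwiseDisjoint OrderedSetPartition.support
  cover : ∀ i : Fin n, ∃ S ∈ parts, i ∈ S.support

/-- A composite set partition is standard if the first block of each of its members contains the
minimal label of that member. -/
def CompositeSetPartition.IsStandard {n : ℕ} (C : CompositeSetPartition n) : Prop :=
  ∀ S ∈ C.parts, ∃ B, S.blocks.head? = some B ∧ ∃ a ∈ B, ∀ b ∈ S.support, a ≤ b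

def StandardCompositeSetPartition (n : ℕ) : Type :=
  {C : CompositeSetPartition n // C.IsStandard}

section

open scoped Pointwise

/-- The convolution product `[C₁] • ⋯ • [C_l]` of the characteristic functions of a finite family
of cones: the characteristic function of their Minkowski sum `C₁ + ⋯ + C_l`. (The sum of sets is
the pointwise one.) -/
def convolution {n : ℕ} {ι : Type*} (s : Finset ι) (C : ι → Set (V0 n)) : V0 n → ℂ :=
  charFn (∑ i ∈ s, C i)

end

/-- The function `[[𝐒₁]] • ⋯ • [[𝐒_l]]` labeled by a composite set partition `{𝐒₁, …, 𝐒_l}`. -/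
def CompositeSetPartition.product {n : ℕ} (C : CompositeSetPartition n) : V0 n → ℂ :=
  convolution C.parts OrderedSetPartition.plate

/-- The packed word `(c₁, …, cₙ)` of an ordered set partition `(T₁, …, T_k)` of all the labels:
`c_i = j - 1` if `i ∈ T_j`. -/
def packedWord {n : ℕ} (p : FullOrderedSetPartition n) : Fin n → ℕ :=
  fun i => p.1.blocks.findIdx fun B => decide (i ∈ B)

/-- The lexicographic order of packed words. -/
def LexLT {n : ℕ} (p q : FullOrderedSetPartition n) : Prop :=
  toLex (packedWord p) < toLex (packedWord q)

/-- The ordered set partition `p` is the concatenation of the members of the composite set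
partition `C`, arranged from left to right by decreasing minimal label. -/
def IsDecreasingConcat {n : ℕ} (p : FullOrderedSetPartition n) (C : CompositeSetPartition n) :
    Prop :=
  ∃ L : List (OrderedSetPartition n), L.Nodup ∧ (∀ S, S ∈ L ↔ S ∈ C.parts) ∧
    L.Pairwise (fun S T => T.support.min < S.support.min) ∧
    p.1.blocks = (L.map OrderedSetPartition.blocks).flatten

end Plates

end

noncomputable section

namespace Plates

/-! On `V0 n` the sum over an initial union of blocks is minus the sum over the complementary
terminal union, so the plate of a full ordered partition is cut out by "terminal sums are
nonpositive". These inequalities make sense on all of `Fin n → ℝ`, where they define `suffixCone`.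

Independence of the plates uses the Euler characteristic. In a linear relation between closed convex
cones, the coefficients of the cones on which a given linear form takes a positive value sum to zero
(`sum_pos_eq_zero`). Take as form the packed word of `q`. It is nonpositive on the plate of `q`, and
nonpositive on the plate of `p` only if the preorder of labels given by `p` is contained in that of
`q`. Induction on these preorders kills all coefficients.

The Minkowski sum of plates with disjoint supports has as indicator the pointwise product of the
indicators `coneFn` (`product_apply`). Such products expand by a quasi-shuffle rule
(`coneFn_mul_sub_append_mem_span`): the concatenation appears with coefficient one, and every other
term moves the first block of the second factor to an earlier position. If the second factor carries
the globally minimal label in its first block, such a move makes the packed word smaller.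
Multiplying the members by decreasing minimum therefore gives the unitriangular expansion.

An ordered partition factors uniquely into standard pieces with decreasing minima, which gives the
bijection. A unitriangular family indexed by a finite basis is again a basis. -/

/-- A list of nonempty pairwise disjoint blocks. -/
structure IsOrdered {n : ℕ} (L : List (Finset (Fin n))) : Prop where
  nonempty : ∀ B ∈ L, B.Nonempty
  disjoint : L.Pairwise Disjoint

/-- The position of the first block of `L` that contains `i`. -/
def blockIndex {n : ℕ} (L : List (Finset (Fin n))) (i : Fin n) : ℕ :=
  L.findIdx fun B => decide (i ∈ B)

/-! ### Ordered lists of blocks and the preorders they define -/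

section Lists

variable {n : ℕ} {L M : List (Finset (Fin n))} {A B : Finset (Fin n)} {i j : Fin n}

@[simp] theorem unionOf_nil : unionOf ([] : List (Finset (Fin n))) = ∅ := rfl

@[simp] theorem unionOf_cons : unionOf (B :: L) = B ∪ unionOf L := rfl

@[simp] theorem unionOf_append : unionOf (L ++ M) = unionOf L ∪ unionOf M := by
  induction L with
  | nil => simp
  | cons A L ih => simp [ih, Finset.union_assoc]

theorem mem_unionOf : i ∈ unionOf L ↔ ∃ B ∈ L, i ∈ B := by
  induction L with
  | nil => simp
  | cons A L ih => simp [ih]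

theorem disjoint_unionOf_right : Disjoint A (unionOf L) ↔ ∀ B ∈ L, Disjoint A B := by
  induction L with
  | nil => simp
  | cons B L ih => simp [ih]

theorem isOrdered_nil : IsOrdered ([] : List (Finset (Fin n))) := ⟨by simp, by simp⟩

theorem isOrdered_cons :
    IsOrdered (B :: L) ↔ B.Nonempty ∧ Disjoint B (unionOf L) ∧ IsOrdered L := by
  rw [disjoint_unionOf_right]
  constructor
  · rintro ⟨h₁, h₂⟩
    rw [List.pairwise_cons] at h₂
    exact ⟨h₁ B (by simp), h₂.1, fun C hC => h₁ C (by simp [hC]), h₂.2⟩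
  · rintro ⟨h₁, h₂, h₃, h₄⟩
    refine ⟨?_, List.pairwise_cons.2 ⟨h₂, h₄⟩⟩
    intro C hC
    rcases List.mem_cons.1 hC with rfl | hC
    exacts [h₁, h₃ C hC]

theorem isOrdered_append :
    IsOrdered (L ++ M) ↔ IsOrdered L ∧ IsOrdered M ∧ Disjoint (unionOf L) (unionOf M) := by
  induction L with
  | nil => simp [isOrdered_nil]
  | cons A L ih =>
    simp only [List.cons_append, isOrdered_cons, ih, unionOf_append, unionOf_cons,
      Finset.disjoint_union_right, Finset.disjoint_union_left]
    tauto

@[simp] theorem blockIndex_cons_of_mem (h : i ∈ B) : blockIndex (B :: L) i = 0 := by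
  simp [blockIndex, List.findIdx_cons, h]

@[simp] theorem blockIndex_cons_of_notMem (h : i ∉ B) :
    blockIndex (B :: L) i = blockIndex L i + 1 := by
  simp [blockIndex, List.findIdx_cons, h]

theorem blockIndex_append_of_mem (h : i ∈ unionOf L) :
    blockIndex (L ++ M) i = blockIndex L i := by
  induction L with
  | nil => simp at h
  | cons A L ih =>
    by_cases hA : i ∈ A
    · simp [hA]
    · have := ih (by simpa [hA] using h)
      simp [hA, this]

theorem blockIndex_append_of_notMem (h : i ∉ unionOf L) :
    blockIndex (L ++ M) i = L.length + blockIndex M i := by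
  induction L with
  | nil => simp
  | cons A L ih =>
    simp only [unionOf_cons, Finset.mem_union, not_or] at h
    simp [h.1, ih h.2]
    omega

/-- Terminal unions of blocks are up-sets for the preorder given by block positions. -/
theorem mem_unionOf_suffix (hL : IsOrdered L) (hM : M <:+ L) (hi : i ∈ unionOf M)
    (hj : j ∈ unionOf L) (hij : blockIndex L i ≤ blockIndex L j) : j ∈ unionOf M := by
  induction L with
  | nil => simp at hj
  | cons B L ih =>
    rcases List.suffix_cons_iff.1 hM with rfl | hM
    · exact hj
    · have hi' : i ∈ unionOf L := by
        obtain ⟨T, rfl⟩ := hM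
        simp [hi]
      obtain ⟨-, hB, hL⟩ := isOrdered_cons.1 hL
      have hiB : i ∉ B := fun h => Finset.disjoint_left.1 hB h hi'
      have hjB : j ∉ B := fun h => by simp [hiB, h] at hij
      refine ih hL hM (by simpa [hjB] using hj) ?_
      simpa [hiB, hjB] using hij

/-- The first block is the set of minimal elements of the preorder; remove it and recurse. -/
theorem eq_of_blockIndex_le_iff (hL : IsOrdered L) (hM : IsOrdered M)
    (hU : unionOf L = unionOf M)
    (h : ∀ i ∈ unionOf L, ∀ j ∈ unionOf L,
      blockIndex L i ≤ blockIndex L j ↔ blockIndex M i ≤ blockIndex M j) : L = M := by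
  induction L generalizing M with
  | nil =>
    cases M with
    | nil => rfl
    | cons B M =>
      obtain ⟨b, hb⟩ := hM.nonempty B (by simp)
      have : b ∈ unionOf (B :: M) := by simp [hb]
      rw [← hU] at this
      simp at this
  | cons A L ih =>
    cases M with
    | nil =>
      obtain ⟨b, hb⟩ := hL.nonempty A (by simp)
      have : b ∈ unionOf (A :: L) := by simp [hb]
      rw [hU] at this
      simp at this
    | cons B M =>
      obtain ⟨⟨a, ha⟩, hAL, hL⟩ := isOrdered_cons.1 hL
      obtain ⟨⟨b, hb⟩, hBM, hM'⟩ := isOrdered_cons.1 hM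
      have hbL : b ∈ unionOf (A :: L) := by rw [hU]; simp [hb]
      have haL : a ∈ unionOf (A :: L) := by simp [ha]
      have hAB : A = B := by
        ext i
        constructor
        · intro hi
          have := (h i (by simp [hi]) b hbL).1 (by simp [hi])
          by_contra hiB
          simp [hiB, hb] at this
        · intro hi
          have := (h i (by rw [hU]; simp [hi]) a haL).2 (by simp [hi])
          by_contra hiA
          simp [hiA, ha] at this
      subst hAB
      have hLM : unionOf L = unionOf M := by
        ext i
        have := congrArg (i ∈ ·) hU
        simp only [unionOf_cons, Finset.mem_union, eq_iff_iff] at this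
        have h₁ := @Finset.disjoint_left _ A (unionOf L)
        have h₂ := @Finset.disjoint_left _ A (unionOf M)
        constructor
        · intro hi
          exact (this.1 (Or.inr hi)).resolve_left fun h => h₁.1 hAL h hi
        · intro hi
          exact (this.2 (Or.inr hi)).resolve_left fun h => h₂.1 hBM h hi
      congr 1
      refine ih hL hM' hLM fun i hi j hj => ?_
      have hiA : i ∉ A := fun h => Finset.disjoint_left.1 hAL h hi
      have hjA : j ∉ A := fun h => Finset.disjoint_left.1 hAL h hj
      simpa [hiA, hjA] using h i (by simp [hi]) j (by simp [hj])

end Lists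

/-! ### Quasi-shuffle expansion of products of cone indicators -/

/-- The cone of all vectors whose sums over the terminal unions of blocks are nonpositive. -/
def suffixCone {n : ℕ} (L : List (Finset (Fin n))) : Set (Fin n → ℝ) :=
  {x | ∀ M, M <:+ L → ∑ i ∈ unionOf M, x i ≤ 0}

/-- The characteristic function of `suffixCone L`. -/
def coneFn {n : ℕ} (L : List (Finset (Fin n))) : (Fin n → ℝ) → ℂ :=
  (suffixCone L).indicator 1

section Shuffle

variable {n : ℕ} {L M N : List (Finset (Fin n))} {A B C : Finset (Fin n)} {x : Fin n → ℝ}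

@[simp] theorem mem_suffixCone_nil : x ∈ suffixCone ([] : List (Finset (Fin n))) := by
  intro M hM
  simp [List.suffix_nil.1 hM]

theorem mem_suffixCone_cons :
    x ∈ suffixCone (B :: L) ↔ ∑ i ∈ unionOf (B :: L), x i ≤ 0 ∧ x ∈ suffixCone L := by
  simp only [suffixCone, Set.mem_ofPred_eq, List.suffix_cons_iff]
  constructor
  · intro h
    exact ⟨h _ (Or.inl rfl), fun M hM => h M (Or.inr hM)⟩
  · rintro ⟨h₁, h₂⟩ M (rfl | hM)
    exacts [h₁, h₂ M hM]

theorem sum_nonpos_of_mem_suffixCone (h : x ∈ suffixCone L) : ∑ i ∈ unionOf L, x i ≤ 0 :=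
  h L (List.suffix_refl L)

@[simp] theorem coneFn_nil : coneFn ([] : List (Finset (Fin n))) = 1 := by
  ext x
  simp [coneFn]

/-- The characteristic function of the half-space `∑_{i ∈ J} x_i ≤ 0`. -/
def halfFn {n : ℕ} (J : Finset (Fin n)) : (Fin n → ℝ) → ℂ :=
  Set.indicator {x | ∑ i ∈ J, x i ≤ 0} 1

theorem coneFn_cons : coneFn (B :: L) = halfFn (B ∪ unionOf L) * coneFn L := by
  classical
  ext x
  have := mem_suffixCone_cons (x := x) (B := B) (L := L)
  simp only [unionOf_cons] at this
  simp only [coneFn, halfFn, Pi.mul_apply, Set.indicator_apply, this, Set.mem_ofPred_eq]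
  split_ifs <;> simp_all

/-- For real `a`, `b`, one has `[a ≤ 0][b ≤ 0] = [a + b ≤ 0]([a ≤ 0] + [b ≤ 0] - 1)`: if `a + b ≤ 0`
then at least one of the two is nonpositive, and if `a + b > 0` then not both are. Here `a`, `b` are
the total sums over the two lists. -/
theorem coneFn_cons_mul_coneFn_cons
    (h : Disjoint (unionOf (A :: L)) (unionOf (B :: M))) :
    coneFn (A :: L) * coneFn (B :: M) =
      halfFn (unionOf (A :: L) ∪ unionOf (B :: M)) *
        (coneFn L * coneFn (B :: M) + coneFn (A :: L) * coneFn M - coneFn L * coneFn M) := by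
  classical
  ext x
  have hA := mem_suffixCone_cons (x := x) (B := A) (L := L)
  have hB := mem_suffixCone_cons (x := x) (B := B) (L := M)
  have hs := Finset.sum_union (f := x) h
  simp only [coneFn, halfFn, Pi.mul_apply, Pi.add_apply, Pi.sub_apply, Set.indicator_apply,
    hA, hB, Set.mem_ofPred_eq, hs]
  by_cases h₁ : x ∈ suffixCone L <;> by_cases h₂ : x ∈ suffixCone M <;> simp only [h₁, h₂] <;>
    by_cases h₃ : ∑ i ∈ unionOf (A :: L), x i ≤ 0 <;>
    by_cases h₄ : ∑ i ∈ unionOf (B :: M), x i ≤ 0 <;> simp only [h₃, h₄] <;>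
    by_cases h₅ : ∑ i ∈ unionOf (A :: L), x i + ∑ i ∈ unionOf (B :: M), x i ≤ 0 <;>
    first
      | (exfalso; linarith)
      | (simp only [h₅]; norm_num)

/-- The ordered lists that partition the same set as `L ++ M` into at most as many blocks. -/
def Merged {n : ℕ} (L M N : List (Finset (Fin n))) : Prop :=
  IsOrdered N ∧ unionOf N = unionOf L ∪ unionOf M ∧ N.length ≤ L.length + M.length

/-- The lists of `Merged L M` in which the first block of `M` comes earlier than in `L ++ M`. -/
def StrictMerged {n : ℕ} (L M N : List (Finset (Fin n))) : Prop :=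
  Merged L M N ∧ ∀ B ∈ M.head?, ∀ b ∈ B, blockIndex N b < L.length

/-- Multiplying by the half-space indicator of the whole support prepends the block `C` to every
list of an expansion. -/
theorem halfFn_mul_mem_span {P Q : List (Finset (Fin n)) → Prop} {J : Finset (Fin n)}
    {f : (Fin n → ℝ) → ℂ}
    (hf : f ∈ Submodule.span ℂ (coneFn '' {N | P N}))
    (hPQ : ∀ N, P N → C ∪ unionOf N = J ∧ Q (C :: N)) :
    halfFn J * f ∈ Submodule.span ℂ (coneFn '' {N | Q N}) := by
  have : Submodule.span ℂ (coneFn '' {N | P N}) ≤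
      (Submodule.span ℂ (coneFn '' {N | Q N})).comap (LinearMap.mulLeft ℂ (halfFn J)) := by
    rw [Submodule.span_le]
    rintro _ ⟨N, hN, rfl⟩
    obtain ⟨h₁, h₂⟩ := hPQ N hN
    refine Submodule.subset_span ⟨C :: N, h₂, ?_⟩
    rw [coneFn_cons, h₁]
    rfl
  exact this hf

/-- The three terms of `coneFn_cons_mul_coneFn_cons` correspond to a merged list starting with `A`,
with `B`, or with `A ∪ B`. In the last two cases `B` is already at position zero. In the first, the
induction hypothesis applies after its own leading concatenation is split off; prepending `A` turns
that one into `A :: L ++ B :: M`. -/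
theorem coneFn_mul_sub_append_mem_span (h : IsOrdered (L ++ M)) :
    coneFn L * coneFn M - coneFn (L ++ M) ∈
      Submodule.span ℂ (coneFn '' {N | StrictMerged L M N}) := by
  induction L generalizing M with
  | nil => simp
  | cons A L ihL =>
    induction M with
    | nil => simp
    | cons B M ihM =>
      obtain ⟨hAL, hBM, hd⟩ := isOrdered_append.1 h
      obtain ⟨hA, hdA, hL⟩ := isOrdered_cons.1 hAL
      obtain ⟨hB, hdB, hM⟩ := isOrdered_cons.1 hBM
      have hd' := hd
      simp only [unionOf_cons, Finset.disjoint_union_right, Finset.disjoint_union_left] at hd'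
      obtain ⟨⟨hAB, hLB⟩, hAM, hLM⟩ := hd'
      set J := unionOf (A :: L) ∪ unionOf (B :: M) with hJ
      -- Adding the concatenation back gives the full product, at the cost of the strict position
      -- bound.
      have key : ∀ {L' M' : List (Finset (Fin n))}, IsOrdered (L' ++ M') →
          coneFn L' * coneFn M' - coneFn (L' ++ M') ∈
            Submodule.span ℂ (coneFn '' {N | StrictMerged L' M' N}) →
          coneFn L' * coneFn M' ∈ Submodule.span ℂ (coneFn '' {N | Merged L' M' N}) := by
        intro L' M' ho hm
        have h₁ : coneFn (L' ++ M') ∈ Submodule.span ℂ (coneFn '' {N | Merged L' M' N}) :=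
          Submodule.subset_span ⟨_, ⟨ho, by simp, by simp⟩, rfl⟩
        have h₂ := Submodule.span_mono (Set.image_mono fun N hN => hN.1) hm
        have := Submodule.add_mem _ h₂ h₁
        rwa [sub_add_cancel] at this
      have o₁ : IsOrdered (L ++ B :: M) :=
        isOrdered_append.2 ⟨hL, hBM, by simp [hLB, hLM]⟩
      have o₂ : IsOrdered (A :: L ++ M) :=
        isOrdered_append.2 ⟨hAL, hM, by simp [hAM, hLM]⟩
      have o₃ : IsOrdered (L ++ M) := isOrdered_append.2 ⟨hL, hM, hLM⟩
      have t₁ : halfFn J * (coneFn L * coneFn (B :: M) - coneFn (L ++ B :: M)) ∈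
          Submodule.span ℂ (coneFn '' {N | StrictMerged (A :: L) (B :: M) N}) := by
        refine halfFn_mul_mem_span (C := A) (ihL o₁) ?_
        rintro N ⟨⟨hN, hU, hl⟩, hi⟩
        have hdN : Disjoint A (unionOf N) := by
          rw [hU]; simp [hdA, hAB, hAM]
        refine ⟨by simp [hU, hJ], ⟨isOrdered_cons.2 ⟨hA, hdN, hN⟩, by simp [hU],
          by simp at hl ⊢; omega⟩, ?_⟩
        intro B' hB' b hb
        have hbi := hi B' hB' b hb
        simp only [List.head?_cons, Option.mem_def, Option.some.injEq] at hB'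
        subst hB'
        have hbA : b ∉ A := fun h => Finset.disjoint_left.1 hAB h hb
        simpa [hbA] using hbi
      have t₂ : halfFn J * (coneFn (A :: L) * coneFn M) ∈
          Submodule.span ℂ (coneFn '' {N | StrictMerged (A :: L) (B :: M) N}) := by
        refine halfFn_mul_mem_span (C := B) (key o₂ (ihM o₂)) ?_
        rintro N ⟨hN, hU, hl⟩
        have hdN : Disjoint B (unionOf N) := by
          rw [hU]; simp [hdB, hAB.symm, hLB.symm]
        have hU' : B ∪ unionOf N = unionOf (A :: L) ∪ unionOf (B :: M) := by
          rw [hU, unionOf_cons, unionOf_cons, Finset.union_left_comm]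
        refine ⟨hU', ⟨isOrdered_cons.2 ⟨hB, hdN, hN⟩, hU',
          by simp at hl ⊢; omega⟩, ?_⟩
        intro B' hB' b hb
        simp only [List.head?_cons, Option.mem_def, Option.some.injEq] at hB'
        subst hB'
        simp [hb]
      have t₃ : halfFn J * (coneFn L * coneFn M) ∈
          Submodule.span ℂ (coneFn '' {N | StrictMerged (A :: L) (B :: M) N}) := by
        refine halfFn_mul_mem_span (C := A ∪ B) (key o₃ (ihL o₃)) ?_
        rintro N ⟨hN, hU, hl⟩
        have hdN : Disjoint (A ∪ B) (unionOf N) := by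
          rw [hU]; simp [hdA, hdB, hAM, hLB.symm]
        have hU' : (A ∪ B) ∪ unionOf N = unionOf (A :: L) ∪ unionOf (B :: M) := by
          rw [hU, unionOf_cons, unionOf_cons, Finset.union_union_union_comm]
        refine ⟨hU', ⟨isOrdered_cons.2 ⟨hA.mono Finset.subset_union_left, hdN, hN⟩, hU',
          by simp at hl ⊢; omega⟩, ?_⟩
        intro B' hB' b hb
        simp only [List.head?_cons, Option.mem_def, Option.some.injEq] at hB'
        subst hB'
        simp [hb]
      have e : coneFn (A :: L ++ B :: M) = halfFn J * coneFn (L ++ B :: M) := by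
        rw [List.cons_append, coneFn_cons, hJ]
        simp
      rw [coneFn_cons_mul_coneFn_cons hd, ← hJ, e]
      have := Submodule.sub_mem _ (Submodule.add_mem _ t₁ t₂) t₃
      convert this using 1
      ring

end Shuffle

/-! ### Euler characteristic of compact convex sets -/

section Euler

/-- Passing from `t` to a point just right of `t` loses exactly the intervals ending at `t`. So the
coefficients with a given right endpoint sum to zero, and summing over the endpoints gives the
claim. -/
theorem sum_eq_zero_of_sum_Icc_eq_zero {ι : Type*} (s : Finset ι) (a : ι → ℂ) (l r : ι → ℝ)
    (hlr : ∀ i ∈ s, l i ≤ r i)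
    (h : ∀ t, ∑ i ∈ s, (Set.Icc (l i) (r i)).indicator (fun _ => a i) t = 0) :
    ∑ i ∈ s, a i = 0 := by
  classical
  have key : ∀ t, ∑ i ∈ s with r i = t, a i = 0 := by
    intro t
    have hev : ∀ᶠ u in nhdsWithin t (Set.Ioi t),
        ∀ i ∈ s, (u ∈ Set.Icc (l i) (r i) ↔ (t ∈ Set.Icc (l i) (r i) ∧ r i ≠ t)) := by
      rw [Filter.eventually_all_finset]
      intro i _
      have h₀ : ∀ᶠ u in nhdsWithin t (Set.Ioi t), t < u := self_mem_nhdsWithin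
      have h₁ : ∀ᶠ u in nhdsWithin t (Set.Ioi t), t < l i → u < l i := by
        by_cases hl : t < l i
        · filter_upwards [nhdsWithin_le_nhds (Iio_mem_nhds hl)] with u hu _ using hu
        · simp [hl]
      have h₂ : ∀ᶠ u in nhdsWithin t (Set.Ioi t), t < r i → u < r i := by
        by_cases hl : t < r i
        · filter_upwards [nhdsWithin_le_nhds (Iio_mem_nhds hl)] with u hu _ using hu
        · simp [hl]
      filter_upwards [h₀, h₁, h₂] with u h₀ h₁ h₂
      simp only [Set.mem_Icc]
      constructor
      · rintro ⟨h₃, h₄⟩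
        refine ⟨⟨?_, by linarith⟩, by intro h; linarith⟩
        by_contra hc
        have := h₁ (not_le.1 hc)
        linarith
      · rintro ⟨⟨h₃, h₄⟩, h₅⟩
        have := h₂ (lt_of_le_of_ne h₄ (Ne.symm h₅))
        exact ⟨by linarith, this.le⟩
    obtain ⟨u, hu⟩ := hev.exists
    have e := (h t).trans (h u).symm
    rw [← sub_eq_zero, ← Finset.sum_sub_distrib] at e
    rw [← e, Finset.sum_filter]
    refine Finset.sum_congr rfl fun i hi => ?_
    have hi' := hu i hi
    have := hlr i hi
    simp only [Set.indicator_apply, hi']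
    by_cases hr : r i = t
    · subst hr
      simp [this]
    · simp [hr]
  rw [← Finset.sum_fiberwise_of_maps_to (t := s.image r)
    (fun i hi => Finset.mem_image_of_mem r hi)]
  exact Finset.sum_eq_zero fun t _ => key t

open Classical in
-- The image under `f` of a nonempty compact convex set is a compact interval, and it contains `t`
-- exactly when the slice `f = t` is nonempty. This reduces the claim to intervals.
theorem sum_nonempty_eq_zero_of_slices {ι : Type*} {E : Type*} [AddCommGroup E] [Module ℝ E]
    [TopologicalSpace E] (s : Finset ι) (a : ι → ℂ) (K : ι → Set E)
    (hK : ∀ i ∈ s, IsCompact (K i)) (hc : ∀ i ∈ s, Convex ℝ (K i)) (f : E →L[ℝ] ℝ)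
    (h : ∀ t, ∑ i ∈ s with (K i ∩ {x | f x = t}).Nonempty, a i = 0) :
    ∑ i ∈ s with (K i).Nonempty, a i = 0 := by
  refine sum_eq_zero_of_sum_Icc_eq_zero _ a (fun i => sInf (f '' K i)) (fun i => sSup (f '' K i))
    ?_ ?_
  · intro i hi
    rw [Finset.mem_filter] at hi
    have hk := (hK i hi.1).image f.continuous
    exact csInf_le_csSup (hi.2.image f) hk.bddBelow hk.bddAbove
  · intro t
    rw [← h t, Finset.sum_filter, Finset.sum_filter]
    refine Finset.sum_congr rfl fun i hi => ?_
    by_cases hne : (K i).Nonempty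
    · have hk := (hK i hi).image f.continuous
      have hcv : Convex ℝ (f '' K i) := (hc i hi).linear_image f.toLinearMap
      have := eq_Icc_of_connected_compact ⟨hne.image f, hcv.isPreconnected⟩ hk
      rw [if_pos hne, ← this, Set.indicator_apply]
      congr 1
    · rw [if_neg hne, if_neg]
      rintro ⟨x, hx, -⟩
      exact hne ⟨x, hx⟩

open Classical in
/-- The Euler characteristic of a finite combination of characteristic functions of compact convex
sets depends only on that combination. -/
theorem sum_nonempty_eq_zero {ι κ : Type*} [Fintype κ] (s : Finset ι) (a : ι → ℂ)
    (K : ι → Set (κ → ℝ)) (hK : ∀ i ∈ s, IsCompact (K i)) (hc : ∀ i ∈ s, Convex ℝ (K i))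
    (h : ∀ x, ∑ i ∈ s with x ∈ K i, a i = 0) :
    ∑ i ∈ s with (K i).Nonempty, a i = 0 := by
  -- Slices with all coordinates fixed are points, where the hypothesis applies; coordinates are
  -- then released one at a time.
  have key : ∀ T : Finset κ,
      (∀ c : κ → ℝ, ∑ i ∈ s with (K i ∩ {x | ∀ j ∈ T, x j = c j}).Nonempty, a i = 0) →
      ∑ i ∈ s with (K i).Nonempty, a i = 0 := by
    intro T
    induction T using Finset.induction_on with
    | empty => intro h; simpa using h 0
    | insert k T hk ih =>
      intro h
      refine ih fun c => ?_
      have hset : {x : κ → ℝ | ∀ j ∈ T, x j = c j} =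
          ⋂ j ∈ T, (ContinuousLinearMap.proj (R := ℝ) (φ := fun _ : κ => ℝ) j) ⁻¹' {c j} := by
        ext x; simp
      have hcl : IsClosed {x : κ → ℝ | ∀ j ∈ T, x j = c j} := by
        rw [hset]
        exact isClosed_biInter fun j _ => isClosed_singleton.preimage (by fun_prop)
      have hcv : Convex ℝ {x : κ → ℝ | ∀ j ∈ T, x j = c j} := by
        rw [hset]
        exact convex_iInter₂ fun j _ => (convex_singleton _).linear_preimage
          (ContinuousLinearMap.proj (R := ℝ) (φ := fun _ : κ => ℝ) j).toLinearMap
      refine sum_nonempty_eq_zero_of_slices s a _ (fun i hi => (hK i hi).inter_right hcl)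
        (fun i hi => (hc i hi).inter hcv) (ContinuousLinearMap.proj k) fun t => ?_
      rw [← h (Function.update c k t)]
      congr 1
      refine Finset.filter_congr fun i _ => ?_
      rw [Set.inter_assoc]
      congr! 2
      ext x
      simp only [Set.mem_inter_iff, Set.mem_ofPred_eq, Finset.forall_mem_insert,
        Function.update_self, ContinuousLinearMap.proj_apply]
      have : ∀ j ∈ T, Function.update c k t j = c j := fun j hj =>
        Function.update_of_ne (by rintro rfl; exact hk hj) _ _
      constructor
      · rintro ⟨h₁, h₂⟩
        exact ⟨h₂, fun j hj => by rw [this j hj, h₁ j hj]⟩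
      · rintro ⟨h₁, h₂⟩
        exact ⟨fun j hj => by rw [← this j hj, h₂ j hj], h₁⟩
  refine key Finset.univ fun c => ?_
  rw [← h c]
  congr 1
  refine Finset.filter_congr fun i _ => ?_
  constructor
  · rintro ⟨x, hx, hxc⟩
    have : x = c := funext fun j => hxc j (Finset.mem_univ j)
    exact this ▸ hx
  · intro hc
    exact ⟨c, hc, fun _ _ => rfl⟩

open Classical in
/-- For a linear relation between characteristic functions of closed convex cones, the coefficients
of the cones on which a given linear form takes a positive value sum to zero. -/
theorem sum_pos_eq_zero {ι κ : Type*} [Fintype κ] [Fintype ι] (a : ι → ℂ)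
    (K : ι → Set (κ → ℝ)) (hK : ∀ i, IsClosed (K i)) (hc : ∀ i, Convex ℝ (K i))
    (hs : ∀ i, ∀ x ∈ K i, ∀ r : ℝ, 0 ≤ r → r • x ∈ K i) (f : (κ → ℝ) →L[ℝ] ℝ)
    (h : ∀ x, ∑ i with x ∈ K i, a i = 0) :
    ∑ i with ∃ x ∈ K i, 0 < f x, a i = 0 := by
  have hp : ∀ i, ∃ p, (∃ x ∈ K i, 0 < f x) → p ∈ K i ∧ 1 ≤ f p := by
    intro i
    by_cases hx : ∃ x ∈ K i, 0 < f x
    · obtain ⟨x, hx, hf⟩ := hx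
      refine ⟨(f x)⁻¹ • x, fun _ => ⟨hs i x hx _ (by positivity), ?_⟩⟩
      simp [hf.ne']
    · exact ⟨0, fun h => absurd h hx⟩
  choose p hp using hp
  obtain ⟨R, hR⟩ : ∃ R : ℝ, ∀ i, ‖p i‖ ≤ R :=
    ⟨∑ i, ‖p i‖, fun i => Finset.single_le_sum (f := fun i => ‖p i‖)
      (fun i _ => norm_nonneg _) (Finset.mem_univ i)⟩
  -- Truncation makes the cones compact. By scaling, a cone with a positive value of `f` reaches `f
  -- ≥ 1`, and `R` is large enough for the ball to keep a witness from each such cone.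
  set D : Set (κ → ℝ) := f ⁻¹' Set.Ici 1 ∩ Metric.closedBall 0 R with hD
  have hDk : IsCompact D := (isCompact_closedBall 0 R).inter_left (isClosed_Ici.preimage f.continuous)
  have hDc : Convex ℝ D :=
    ((convex_Ici 1).linear_preimage f.toLinearMap).inter (convex_closedBall 0 R)
  have := sum_nonempty_eq_zero Finset.univ a (fun i => K i ∩ D)
    (fun i _ => hDk.inter_left (hK i)) (fun i _ => (hc i).inter hDc) (fun x => by
      by_cases hx : x ∈ D
      · simpa [hx] using h x
      · simp [hx])
  rw [← this]
  congr 1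
  refine Finset.filter_congr fun i _ => ?_
  constructor
  · intro hi
    obtain ⟨h₁, h₂⟩ := hp i hi
    exact ⟨p i, h₁, h₂, by simpa using hR i⟩
  · rintro ⟨x, h₁, h₂, -⟩
    exact ⟨x, h₁, lt_of_lt_of_le one_pos h₂⟩

end Euler

/-! ### Linear independence of the plates -/

section Independence

variable {n : ℕ} {L M : List (Finset (Fin n))}

/-- Abel summation: the form with coefficients `blockIndex L` is the sum of the sums over the proper
terminal unions. -/
theorem sum_blockIndex_mul_nonpos (hL : IsOrdered L) {x : Fin n → ℝ} (hx : x ∈ suffixCone L) :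
    ∑ i ∈ unionOf L, (blockIndex L i : ℝ) * x i ≤ 0 := by
  induction L with
  | nil => simp
  | cons B L ih =>
    obtain ⟨-, hd, hL⟩ := isOrdered_cons.1 hL
    obtain ⟨-, hx⟩ := mem_suffixCone_cons.1 hx
    rw [unionOf_cons, Finset.sum_union hd]
    have h₁ : ∑ i ∈ B, (blockIndex (B :: L) i : ℝ) * x i = 0 :=
      Finset.sum_eq_zero fun i hi => by simp [hi]
    have h₂ : ∑ i ∈ unionOf L, (blockIndex (B :: L) i : ℝ) * x i =
        ∑ i ∈ unionOf L, (blockIndex L i : ℝ) * x i + ∑ i ∈ unionOf L, x i := by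
      rw [← Finset.sum_add_distrib]
      refine Finset.sum_congr rfl fun i hi => ?_
      rw [blockIndex_cons_of_notMem fun h => Finset.disjoint_left.1 hd h hi]
      push_cast
      ring
    rw [h₁, h₂]
    linarith [ih hL hx, sum_nonpos_of_mem_suffixCone hx]

/-- A terminal union that contains `i` also contains `j`, so the `+1` is always cancelled. -/
theorem single_sub_single_mem_suffixCone (hL : IsOrdered L) {i j : Fin n}
    (hj : j ∈ unionOf L) (hij : blockIndex L i ≤ blockIndex L j) :
    (Pi.single i 1 - Pi.single j 1 : Fin n → ℝ) ∈ suffixCone L := by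
  intro M hM
  simp only [Pi.sub_apply, Finset.sum_sub_distrib, Finset.sum_pi_single']
  have := fun h => mem_unionOf_suffix hL hM (i := i) h hj hij
  by_cases hi : i ∈ unionOf M
  · simp [hi, this hi]
  · simp only [hi, if_false]
    split_ifs <;> norm_num

theorem isClosed_suffixCone : IsClosed (suffixCone L) := by
  have : suffixCone L = ⋂ M, ⋂ (_ : M <:+ L), {x | ∑ i ∈ unionOf M, x i ≤ 0} := by
    ext x; simp [suffixCone]
  rw [this]
  exact isClosed_iInter fun M => isClosed_iInter fun _ =>
    isClosed_le (by fun_prop) continuous_const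

theorem convex_suffixCone : Convex ℝ (suffixCone L) := by
  intro x hx y hy a b ha hb _ M hM
  have h₁ := hx M hM
  have h₂ := hy M hM
  simp only [Pi.add_apply, Pi.smul_apply, smul_eq_mul, Finset.sum_add_distrib, ← Finset.mul_sum]
  nlinarith

theorem smul_mem_suffixCone {x : Fin n → ℝ} (hx : x ∈ suffixCone L) {r : ℝ} (hr : 0 ≤ r) :
    r • x ∈ suffixCone L := by
  intro M hM
  have h₁ := hx M hM
  simp only [Pi.smul_apply, smul_eq_mul, ← Finset.mul_sum]
  nlinarith

theorem isOrdered_blocks (S : OrderedSetPartition n) : IsOrdered S.blocks :=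
  ⟨S.nonempty, S.disjoint⟩

theorem unionOf_blocks (p : FullOrderedSetPartition n) : unionOf p.1.blocks = Finset.univ := p.2

theorem FullOrderedSetPartition.eq_of_blocks {p q : FullOrderedSetPartition n}
    (h : p.1.blocks = q.1.blocks) : p = q :=
  Subtype.ext (OrderedSetPartition.ext h)

theorem FullOrderedSetPartition.eq_of_packedWord_le_iff {p q : FullOrderedSetPartition n}
    (h : ∀ i j, packedWord p i ≤ packedWord p j ↔ packedWord q i ≤ packedWord q j) : p = q :=
  eq_of_blocks (eq_of_blockIndex_le_iff (isOrdered_blocks _) (isOrdered_blocks _)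
    ((unionOf_blocks p).trans (unionOf_blocks q).symm) fun i _ j _ => h i j)

instance : Finite (FullOrderedSetPartition n) := by
  refine Finite.of_injective
    (fun p => {ij : Fin n × Fin n | packedWord p ij.1 ≤ packedWord p ij.2}) fun p q h => ?_
  refine FullOrderedSetPartition.eq_of_packedWord_le_iff fun i j => ?_
  have := congrArg ((i, j) ∈ ·) h
  simpa using this

/-- On `V₀ⁿ`, the inequalities for initial unions of blocks amount to opposite inequalities for
terminal unions. -/
theorem mem_plate_iff (S : OrderedSetPartition n) (x : V0 n) :
    x ∈ S.plate ↔ (∀ i, i ∉ S.support → x.1 i = 0) ∧ x.1 ∈ suffixCone S.blocks := by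
  refine and_congr_right fun h0 => ?_
  have hx : ∑ i ∈ unionOf S.blocks, x.1 i = 0 := by
    rw [← show ∑ i, x.1 i = 0 from x.2]
    exact Finset.sum_subset (Finset.subset_univ _) fun i _ hi => h0 i hi
  have hsum : ∀ P M, P ++ M = S.blocks →
      ∑ i ∈ unionOf P, x.1 i + ∑ i ∈ unionOf M, x.1 i = 0 := by
    intro P M e
    rw [← hx, ← e, unionOf_append, Finset.sum_union]
    exact (isOrdered_append.1 (e ▸ isOrdered_blocks S)).2.2
  constructor
  · rintro h M ⟨P, hP⟩
    have hPM := hsum P M hP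
    rcases eq_or_ne P [] with rfl | hP0
    · simp at hPM; exact hPM.le
    rcases eq_or_ne M [] with rfl | hM0
    · simp
    have := h P.length (List.length_pos_iff.2 hP0) (by
      rw [← hP, List.length_append]
      have := List.length_pos_iff.2 hM0
      omega)
    rw [← hP, List.take_left] at this
    linarith
  · intro h j _ _
    have := h (S.blocks.drop j) (List.drop_suffix _ _)
    have := hsum _ _ (List.take_append_drop j S.blocks)
    linarith

theorem charFn_plate (p : FullOrderedSetPartition n) (x : V0 n) :
    charFn p.1.plate x = coneFn p.1.blocks x.1 := by
  classical
  have : x ∈ p.1.plate ↔ x.1 ∈ suffixCone p.1.blocks := by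
    rw [mem_plate_iff]
    have := p.2
    simp [this]
  simp only [charFn, coneFn, Set.indicator_apply, this, Pi.one_apply]

theorem linearIndependent_charFn_plate :
    LinearIndependent ℂ fun p : FullOrderedSetPartition n => charFn p.1.plate := by
  classical
  have := Fintype.ofFinite (FullOrderedSetPartition n)
  rw [Fintype.linearIndependent_iff]
  intro a ha
  have hrel : ∀ x : Fin n → ℝ, ∑ p : FullOrderedSetPartition n with
      x ∈ suffixCone p.1.blocks ∩ (V0 n : Set (Fin n → ℝ)), a p = 0 := by
    intro x
    by_cases hx : x ∈ V0 n
    · have := congrFun ha ⟨x, hx⟩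
      simp only [Finset.sum_apply, Pi.smul_apply, charFn_plate, smul_eq_mul, Pi.zero_apply] at this
      rw [← this, Finset.sum_filter]
      refine Finset.sum_congr rfl fun p _ => ?_
      simp [coneFn, Set.indicator_apply, hx]
    · simp [hx]
  have hV : IsClosed (V0 n : Set (Fin n → ℝ)) := (V0 n).closed_of_finiteDimensional
  -- All cones contain the origin. Hence the coefficients of the cones on which a form is nowhere
  -- positive also sum to zero.
  have htot : ∑ p, a p = 0 := by
    have := hrel 0
    rwa [Finset.filter_true_of_mem] at this
    intro p _
    refine ⟨?_, (V0 n).zero_mem⟩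
    intro M _
    simp
  have hform : ∀ q : FullOrderedSetPartition n, ∑ p : FullOrderedSetPartition n with
      ¬ ∃ x ∈ suffixCone p.1.blocks ∩ (V0 n : Set (Fin n → ℝ)),
        0 < ∑ i, (packedWord q i : ℝ) * x i, a p = 0 := by
    intro q
    have h₁ := sum_pos_eq_zero a
      (fun p : FullOrderedSetPartition n => suffixCone p.1.blocks ∩ (V0 n : Set (Fin n → ℝ)))
      (fun p => isClosed_suffixCone.inter hV) (fun p => convex_suffixCone.inter (V0 n).convex)
      (fun p x hx r hr => ⟨smul_mem_suffixCone hx.1 hr, (V0 n).smul_mem r hx.2⟩)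
      (∑ i, (packedWord q i : ℝ) • ContinuousLinearMap.proj i)
      (fun x => by convert hrel x)
    have h₂ := Finset.sum_filter_add_sum_filter_not Finset.univ
      (fun p : FullOrderedSetPartition n =>
        ∃ x ∈ suffixCone p.1.blocks ∩ (V0 n : Set (Fin n → ℝ)),
          0 < ∑ i, (packedWord q i : ℝ) * x i) a
    rw [htot] at h₂
    simp only [sum_apply, smul_apply,
      ContinuousLinearMap.proj_apply, smul_eq_mul] at h₁
    rwa [h₁, zero_add] at h₂
  have hself : ∀ q : FullOrderedSetPartition n,
      ¬ ∃ x ∈ suffixCone q.1.blocks ∩ (V0 n : Set (Fin n → ℝ)),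
        0 < ∑ i, (packedWord q i : ℝ) * x i := by
    rintro q ⟨x, hx, h⟩
    have := sum_blockIndex_mul_nonpos (isOrdered_blocks q.1) hx.1
    rw [unionOf_blocks] at this
    exact absurd h (not_lt.2 this)
  have hfiner : ∀ p q : FullOrderedSetPartition n,
      (¬ ∃ x ∈ suffixCone p.1.blocks ∩ (V0 n : Set (Fin n → ℝ)),
        0 < ∑ i, (packedWord q i : ℝ) * x i) →
      ∀ i j, packedWord p i ≤ packedWord p j → packedWord q i ≤ packedWord q j := by
    intro p q h i j hij
    by_contra hlt
    refine h ⟨Pi.single i 1 - Pi.single j 1, ⟨single_sub_single_mem_suffixCone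
      (isOrdered_blocks p.1) (by rw [unionOf_blocks]; simp) hij, ?_⟩, ?_⟩
    · change ∑ k, (Pi.single i 1 - Pi.single j 1 : Fin n → ℝ) k = 0
      simp
    · simp only [Pi.sub_apply, mul_sub, Finset.sum_sub_distrib]
      simpa [Pi.single_apply] using hlt
  let rel : FullOrderedSetPartition n → Set (Fin n × Fin n) :=
    fun p => {ij | packedWord p ij.1 ≤ packedWord p ij.2}
  have hrel_inj : Function.Injective rel := by
    intro p q h
    refine FullOrderedSetPartition.eq_of_packedWord_le_iff fun i j => ?_
    have := congrArg ((i, j) ∈ ·) h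
    simpa [rel] using this
  intro q
  -- Every other `p` in the sum `hform q` has a strictly smaller preorder, so its coefficient
  -- already vanishes.
  induction hr : rel q using WellFoundedLT.induction generalizing q with
  | ind R ih =>
    subst hr
    have := hform q
    rwa [Finset.sum_eq_single_of_mem q (by simp only [Finset.mem_filter_univ]; exact hself q)]
      at this
    intro p hp hpq
    simp only [Finset.mem_filter_univ] at hp
    refine ih (rel p) (lt_of_le_of_ne (fun ij => hfiner p q hp ij.1 ij.2)
      fun e => hpq (hrel_inj e)) p rfl

end Independence

/-! ### Unitriangular expansion of products of standard pieces -/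

section Expansion

variable {n : ℕ}

/-- The first block contains the minimum of the union of all blocks. -/
def HeadMin {n : ℕ} (L : List (Finset (Fin n))) : Prop :=
  ∃ B, L.head? = some B ∧ ∃ a ∈ B, ∀ b ∈ unionOf L, a ≤ b

/-- The concatenation of the blocks of a list of ordered set partitions. -/
def concat {n : ℕ} (P : List (OrderedSetPartition n)) : List (Finset (Fin n)) :=
  (P.map OrderedSetPartition.blocks).flatten

/-- The lists that partition the same set as `L` into at most as many blocks, and whose word of
block positions is lexicographically smaller than that of `L`. -/
def Lower {n : ℕ} (L N : List (Finset (Fin n))) : Prop :=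
  IsOrdered N ∧ unionOf N = unionOf L ∧ N.length ≤ L.length ∧
    ∃ i ∈ unionOf L, (∀ j ∈ unionOf L, j < i → blockIndex N j = blockIndex L j) ∧
      blockIndex N i < blockIndex L i

/-- The globally minimal label lies in the first block of `M`. Its position is `L.length` in `L ++
M` and less than `N.length ≤ L.length` in `K`, so the words already differ at their first letter. -/
theorem lower_append_of_strictMerged {L M N K : List (Finset (Fin n))}
    (hL : IsOrdered (L ++ M)) (hM : HeadMin M)
    (hmin : ∀ a ∈ unionOf M, (∀ b ∈ unionOf M, a ≤ b) → ∀ b ∈ unionOf L, a < b)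
    (hNU : unionOf N = unionOf L) (hNl : N.length ≤ L.length) (hK : StrictMerged N M K) :
    Lower (L ++ M) K := by
  obtain ⟨⟨hK, hU, hl⟩, hi⟩ := hK
  obtain ⟨B, hB, a, ha, hab⟩ := hM
  obtain ⟨M, rfl⟩ := List.head?_eq_some_iff.1 hB
  have haM : a ∈ unionOf (B :: M) := by simp [ha]
  have haL : a ∉ unionOf L :=
    fun h => Finset.disjoint_left.1 (isOrdered_append.1 hL).2.2 h haM
  refine ⟨hK, by rw [hU, hNU, unionOf_append], by rw [List.length_append]; omega, a,
    by rw [unionOf_append]; exact Finset.mem_union_right _ haM, ?_, ?_⟩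
  · intro j hj hja
    rw [unionOf_append, Finset.mem_union] at hj
    rcases hj with hj | hj
    · exact absurd hja (not_lt.2 (hmin a haM hab j hj).le)
    · exact absurd hja (not_lt.2 (hab j hj))
  · rw [blockIndex_append_of_notMem haL, blockIndex_cons_of_mem ha]
    have := hi B (by simp) a ha
    omega

theorem Lower.append {L M N : List (Finset (Fin n))} (hL : IsOrdered (L ++ M)) (hM : HeadMin M)
    (hmin : ∀ a ∈ unionOf M, (∀ b ∈ unionOf M, a ≤ b) → ∀ b ∈ unionOf L, a < b)
    (hN : Lower L N) : Lower (L ++ M) (N ++ M) := by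
  obtain ⟨hN, hU, hl, i, hi, hlt, hii⟩ := hN
  have hd := isOrdered_append.1 hL
  have ho : IsOrdered (N ++ M) := isOrdered_append.2 ⟨hN, hd.2.1, hU ▸ hd.2.2⟩
  have hU' : unionOf (N ++ M) = unionOf (L ++ M) := by rw [unionOf_append, unionOf_append, hU]
  -- If `N` is shorter, the minimal label of `M` moves left and decides. If the lengths agree,
  -- labels of `M` keep their positions and the comparison of `N` with `L` decides. This is why
  -- `Lower` bounds the length.
  rcases hl.lt_or_eq with hl' | hl'
  · obtain ⟨B, hB, a, ha, hab⟩ := hM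
    obtain ⟨M, rfl⟩ := List.head?_eq_some_iff.1 hB
    have haM : a ∈ unionOf (B :: M) := by simp [ha]
    have haL : a ∉ unionOf L := fun h => Finset.disjoint_left.1 hd.2.2 h haM
    refine ⟨ho, hU', by simp only [List.length_append]; omega, a,
      by rw [unionOf_append]; exact Finset.mem_union_right _ haM, ?_, ?_⟩
    · intro j hj hja
      rw [unionOf_append, Finset.mem_union] at hj
      rcases hj with hj | hj
      · exact absurd hja (not_lt.2 (hmin a haM hab j hj).le)
      · exact absurd hja (not_lt.2 (hab j hj))
    · rw [blockIndex_append_of_notMem haL, blockIndex_append_of_notMem (hU ▸ haL)]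
      omega
  · refine ⟨ho, hU', by simp only [List.length_append]; omega, i,
      by rw [unionOf_append]; exact Finset.mem_union_left _ hi, ?_, ?_⟩
    · intro j _ hji
      by_cases hjL : j ∈ unionOf L
      · rw [blockIndex_append_of_mem hjL, blockIndex_append_of_mem (hU ▸ hjL), hlt j hjL hji]
      · rw [blockIndex_append_of_notMem hjL, blockIndex_append_of_notMem (hU ▸ hjL), hl']
    · rwa [blockIndex_append_of_mem hi, blockIndex_append_of_mem (hU ▸ hi)]

@[simp] theorem concat_nil : concat ([] : List (OrderedSetPartition n)) = [] := rfl

@[simp] theorem concat_cons (S : OrderedSetPartition n) (P : List (OrderedSetPartition n)) :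
    concat (S :: P) = S.blocks ++ concat P := by simp [concat]

@[simp] theorem concat_append (P Q : List (OrderedSetPartition n)) :
    concat (P ++ Q) = concat P ++ concat Q := by simp [concat]

theorem mem_unionOf_concat {P : List (OrderedSetPartition n)} {i : Fin n} :
    i ∈ unionOf (concat P) ↔ ∃ S ∈ P, i ∈ S.support := by
  induction P with
  | nil => simp
  | cons S P ih => simp [ih, OrderedSetPartition.support]

theorem isOrdered_concat {P : List (OrderedSetPartition n)} :
    IsOrdered (concat P) ↔ P.Pairwise fun S T => Disjoint S.support T.support := by
  induction P with
  | nil => simp [isOrdered_nil]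
  | cons S P ih =>
    rw [concat_cons, isOrdered_append, ih, List.pairwise_cons]
    have : Disjoint (unionOf S.blocks) (unionOf (concat P)) ↔
        ∀ T ∈ P, Disjoint S.support T.support := by
      rw [Finset.disjoint_right]
      simp only [mem_unionOf_concat, Finset.disjoint_right, OrderedSetPartition.support]
      grind
    rw [this]
    have := isOrdered_blocks S
    tauto

/-- The members of a standard composite set partition, arranged by decreasing minimal label. -/
structure IsStandardList {n : ℕ} (P : List (OrderedSetPartition n)) : Prop where
  headMin : ∀ S ∈ P, HeadMin S.blocks
  decreasing : P.Pairwise fun S T => T.support.min < S.support.min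

theorem lt_of_min_lt {S T : OrderedSetPartition n} (h : T.support.min < S.support.min) {a : Fin n}
    (hT : ∀ b ∈ T.support, a ≤ b) {b : Fin n} (hb : b ∈ S.support) : a < b := by
  have h₁ : (a : WithTop (Fin n)) ≤ T.support.min := Finset.le_min fun b hb =>
    WithTop.coe_le_coe.2 (hT b hb)
  exact WithTop.coe_lt_coe.1 ((h₁.trans_lt h).trans_le (Finset.min_le hb))

/-- Induction from the right: the last piece `S` has the smallest minimum, in its first block, so
multiplying by `coneFn S.blocks` preserves lower terms. -/
theorem prod_coneFn_sub_mem_span {P : List (OrderedSetPartition n)} (hP : IsStandardList P)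
    (ho : IsOrdered (concat P)) :
    (P.map fun S => coneFn S.blocks).prod - coneFn (concat P) ∈
      Submodule.span ℂ (coneFn '' {N | Lower (concat P) N}) := by
  induction P using List.reverseRecOn with
  | nil => simp
  | append_singleton P S ih =>
    obtain ⟨hhead, hdec⟩ := hP
    rw [List.pairwise_append] at hdec
    have hS := hhead S (by simp)
    simp only [concat_append, concat_cons, concat_nil, List.append_nil] at ho ⊢
    have hmin : ∀ a ∈ unionOf S.blocks, (∀ b ∈ unionOf S.blocks, a ≤ b) →
        ∀ b ∈ unionOf (concat P), a < b := by
      intro a _ hab b hb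
      obtain ⟨T, hT, hbT⟩ := mem_unionOf_concat.1 hb
      exact lt_of_min_lt (hdec.2.2 T hT S (by simp)) hab hbT
    have hd := isOrdered_append.1 ho
    have ih := ih ⟨fun T hT => hhead T (by simp [hT]), hdec.1⟩ hd.1
    have hstrict : ∀ N, unionOf N = unionOf (concat P) → N.length ≤ (concat P).length →
        Submodule.span ℂ (coneFn '' {K | StrictMerged N S.blocks K}) ≤
          Submodule.span ℂ (coneFn '' {K | Lower (concat P ++ S.blocks) K}) :=
      fun N hU hl => Submodule.span_mono (Set.image_mono fun K hK =>
        lower_append_of_strictMerged ho hS hmin hU hl hK)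
    have hmul : Submodule.span ℂ (coneFn '' {N | Lower (concat P) N}) ≤
        (Submodule.span ℂ (coneFn '' {K | Lower (concat P ++ S.blocks) K})).comap
          (LinearMap.mulRight ℂ (coneFn S.blocks)) := by
      rw [Submodule.span_le]
      rintro _ ⟨N, hN, rfl⟩
      have h₁ := coneFn_mul_sub_append_mem_span (L := N) (M := S.blocks)
        (isOrdered_append.2 ⟨hN.1, hd.2.1, hN.2.1 ▸ hd.2.2⟩)
      have h₂ : coneFn (N ++ S.blocks) ∈
          Submodule.span ℂ (coneFn '' {K | Lower (concat P ++ S.blocks) K}) :=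
        Submodule.subset_span ⟨_, Lower.append ho hS hmin hN, rfl⟩
      have := Submodule.add_mem _ (hstrict N hN.2.1 hN.2.2.1 h₁) h₂
      rwa [sub_add_cancel] at this
    have h₁ := hstrict _ rfl le_rfl (coneFn_mul_sub_append_mem_span ho)
    have h₂ := hmul ih
    rw [Submodule.mem_comap, LinearMap.mulRight_apply] at h₂
    have := Submodule.add_mem _ h₂ h₁
    convert this using 1
    simp only [List.map_append, List.prod_append, List.map_cons, List.map_nil,
      List.prod_singleton]
    ring

end Expansion

/-! ### Convolution of plates as a pointwise product -/

section Composite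

variable {n : ℕ}

open scoped Pointwise in
theorem CompositeSetPartition.mem_sum_plate (C : CompositeSetPartition n) (x : V0 n) :
    x ∈ ∑ S ∈ C.parts, S.plate ↔ ∀ S ∈ C.parts, x.1 ∈ suffixCone S.blocks := by
  rw [Set.mem_finsetSum]
  constructor
  · rintro ⟨g, hg, rfl⟩ S hS M hM
    have hsub : unionOf M ⊆ S.support := by
      obtain ⟨T, hT⟩ := hM
      rw [OrderedSetPartition.support, ← hT, unionOf_append]
      exact Finset.subset_union_right
    have : ∀ i ∈ unionOf M, (∑ T ∈ C.parts, g T : V0 n).1 i = (g S).1 i := by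
      intro i hi
      rw [AddSubmonoidClass.coe_finsetSum, Finset.sum_apply]
      refine Finset.sum_eq_single_of_mem S hS fun T hT hTS => ?_
      refine ((mem_plate_iff T _).1 (hg hT)).1 i fun hiT => ?_
      exact Finset.disjoint_left.1 (C.disjoint hT hS hTS) hiT (hsub hi)
    rw [Finset.sum_congr rfl this]
    exact ((mem_plate_iff S _).1 (hg hS)).2 M hM
  · intro h
    classical
    have hcov : C.parts.biUnion OrderedSetPartition.support = Finset.univ := by
      ext i
      simpa using C.cover i
    -- Each support sum is nonpositive and together they add up to zero, so each vanishes. Hence the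
    -- restrictions of `x` to the supports lie in `V0 n` and serve as summands.
    have hzero : ∀ S ∈ C.parts, ∑ i ∈ S.support, x.1 i = 0 := by
      have hle : ∀ S ∈ C.parts, ∑ i ∈ S.support, x.1 i ≤ 0 :=
        fun S hS => sum_nonpos_of_mem_suffixCone (h S hS)
      rw [← Finset.sum_eq_zero_iff_of_nonpos hle, ← Finset.sum_biUnion C.disjoint, hcov]
      exact x.2
    have hind : ∀ J S : Finset (Fin n), J ⊆ S →
        ∑ i ∈ J, (if i ∈ S then x.1 i else 0) = ∑ i ∈ J, x.1 i := fun J S hJ =>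
      Finset.sum_congr rfl fun i hi => if_pos (hJ hi)
    have hmem : ∀ S : OrderedSetPartition n, S ∈ C.parts →
        (fun i => if i ∈ S.support then x.1 i else 0) ∈ V0 n := by
      intro S hS
      change ∑ i, (if i ∈ S.support then x.1 i else 0) = 0
      rw [Finset.sum_ite_mem, Finset.univ_inter, hzero S hS]
    refine ⟨fun S => if hS : S ∈ C.parts then ⟨_, hmem S hS⟩ else 0, ?_, ?_⟩
    · intro S hS
      beta_reduce
      rw [dif_pos hS, mem_plate_iff]
      refine ⟨fun i hi => if_neg hi, fun M hM => ?_⟩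
      have hsub : unionOf M ⊆ S.support := by
        obtain ⟨T, hT⟩ := hM
        rw [OrderedSetPartition.support, ← hT, unionOf_append]
        exact Finset.subset_union_right
      exact (hind _ _ hsub).trans_le (h S hS M hM)
    · ext i
      rw [AddSubmonoidClass.coe_finsetSum, Finset.sum_apply]
      obtain ⟨S, hS, hi⟩ := C.cover i
      rw [Finset.sum_eq_single_of_mem S hS]
      · simp [hS, hi]
      · intro T hT hTS
        have : i ∉ T.support := fun hiT => Finset.disjoint_left.1 (C.disjoint hT hS hTS) hiT hi
        simp [hT, this]

theorem CompositeSetPartition.product_apply (C : CompositeSetPartition n) (x : V0 n) :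
    C.product x = ∏ S ∈ C.parts, coneFn S.blocks x.1 := by
  classical
  have := C.mem_sum_plate x
  simp only [CompositeSetPartition.product, convolution, charFn, coneFn, Set.indicator_apply, this,
    Pi.one_apply, Finset.prod_boole]

theorem CompositeSetPartition.isStandardList {C : CompositeSetPartition n} (hC : C.IsStandard)
    {L : List (OrderedSetPartition n)} (hL : ∀ S, S ∈ L ↔ S ∈ C.parts)
    (hd : L.Pairwise fun S T => T.support.min < S.support.min) : IsStandardList L :=
  ⟨fun S hS => hC S ((hL S).1 hS), hd⟩

/-- The canonical basis element of a standard composite set partition is the plate of its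
concatenation plus lexicographically smaller terms. -/
theorem product_sub_charFn_plate_mem_span {p : FullOrderedSetPartition n}
    {C : StandardCompositeSetPartition n} (h : IsDecreasingConcat p C.1) :
    C.1.product - charFn p.1.plate ∈ Submodule.span ℂ
      ((fun q : FullOrderedSetPartition n => charFn q.1.plate) '' {q | LexLT q p}) := by
  classical
  obtain ⟨L, hnd, hL, hd, hb⟩ := h
  change p.1.blocks = concat L at hb
  have hexp := prod_coneFn_sub_mem_span (CompositeSetPartition.isStandardList C.2 hL hd)
    (hb ▸ isOrdered_blocks p.1)
  rw [← hb] at hexp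
  have hle : Submodule.span ℂ (coneFn '' {N | Lower p.1.blocks N}) ≤
      (Submodule.span ℂ ((fun q : FullOrderedSetPartition n => charFn q.1.plate) ''
        {q | LexLT q p})).comap (LinearMap.funLeft ℂ ℂ (Subtype.val : V0 n → Fin n → ℝ)) := by
    rw [Submodule.span_le]
    rintro _ ⟨N, ⟨hN, hU, -, i, -, hlt, hi⟩, rfl⟩
    rw [unionOf_blocks] at hU hlt
    let q : FullOrderedSetPartition n := ⟨⟨N, hN.nonempty, hN.disjoint⟩, hU⟩
    refine Submodule.subset_span ⟨q, ⟨i, fun j hj => hlt j (Finset.mem_univ j) hj, hi⟩, ?_⟩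
    ext x
    exact charFn_plate q x
  have := hle hexp
  rw [Submodule.mem_comap] at this
  convert this using 1
  ext x
  have hparts : C.1.parts = L.toFinset := by ext S; simp [hL]
  rw [Pi.sub_apply, CompositeSetPartition.product_apply, charFn_plate, LinearMap.funLeft_apply,
    Pi.sub_apply, hparts, List.prod_toFinset _ hnd, Pi.list_prod_apply, List.map_map]
  rfl

end Composite

/-! ### Unique factorization into standard pieces -/

section Bijection

variable {n : ℕ}

/-- Cut just before the block containing the minimal label: the rest from there on is the last
piece, and the blocks before it are factored recursively. -/
theorem exists_isStandardList_concat (L : List (Finset (Fin n))) (hL : IsOrdered L) :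
    ∃ P, IsStandardList P ∧ concat P = L := by
  induction hl : L.length using Nat.strong_induction_on generalizing L with
  | _ l ih =>
    rcases eq_or_ne L [] with rfl | hL0
    · exact ⟨[], ⟨by simp, by simp⟩, rfl⟩
    · have hne : (unionOf L).Nonempty := by
        obtain ⟨B, hB⟩ := List.exists_mem_of_ne_nil L hL0
        obtain ⟨b, hb⟩ := hL.nonempty B hB
        exact ⟨b, mem_unionOf.2 ⟨B, hB, hb⟩⟩
      set a := (unionOf L).min' hne
      obtain ⟨B, hB, haB⟩ := mem_unionOf.1 (Finset.min'_mem _ hne)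
      obtain ⟨X, Y, hXY⟩ := List.append_of_mem hB
      have hmin : ∀ b ∈ unionOf L, a ≤ b := fun b hb => Finset.min'_le _ b hb
      have hL' := hL
      rw [hXY] at hL' hmin
      obtain ⟨hX, hY, hd⟩ := isOrdered_append.1 hL'
      obtain ⟨P, hP, hPX⟩ := ih X.length (by rw [← hl, hXY]; simp) X hX rfl
      let S : OrderedSetPartition n := ⟨B :: Y, hY.nonempty, hY.disjoint⟩
      have haS : a ∈ S.support := by
        change a ∈ unionOf (B :: Y)
        simp only [unionOf_cons, Finset.mem_union]
        exact Or.inl haB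
      have hS : ∀ b ∈ unionOf S.blocks, a ≤ b := fun b hb =>
        hmin b (by rw [unionOf_append]; exact Finset.mem_union_right _ hb)
      refine ⟨P ++ [S], ⟨?_, ?_⟩, by simp [hPX, hXY, S]⟩
      · intro T hT
        rcases List.mem_append.1 hT with hT | hT
        · exact hP.headMin T hT
        · rw [List.mem_singleton] at hT
          subst hT
          exact ⟨B, rfl, a, haB, hS⟩
      · rw [List.pairwise_append]
        refine ⟨hP.decreasing, by simp, fun T hT T' hT' => ?_⟩
        rw [List.mem_singleton] at hT'
        subst hT'
        refine (Finset.min_le haS).trans_lt ?_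
        obtain ⟨B₀, hB₀, t, htB, ht⟩ := hP.headMin T hT
        have htT : t ∈ T.support := mem_unionOf.2 ⟨B₀, List.mem_of_mem_head? hB₀, htB⟩
        have hle : (t : WithTop (Fin n)) ≤ T.support.min :=
          Finset.le_min fun b hb => WithTop.coe_le_coe.2 (ht b hb)
        refine lt_of_lt_of_le (WithTop.coe_lt_coe.2 ?_) hle
        have htX : t ∈ unionOf X := by
          rw [← hPX]
          exact mem_unionOf_concat.2 ⟨T, hT, htT⟩
        refine lt_of_le_of_ne (hmin t (by rw [unionOf_append]; exact Finset.mem_union_left _ htX)) ?_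
        intro e
        exact Finset.disjoint_left.1 hd htX (e ▸ haS)

theorem IsStandardList.tail {S : OrderedSetPartition n} {P : List (OrderedSetPartition n)}
    (h : IsStandardList (S :: P)) : IsStandardList P :=
  ⟨fun T hT => h.headMin T (by simp [hT]), (List.pairwise_cons.1 h.decreasing).2⟩

/-- If `T` extended beyond `S`, it would contain the first block of the next piece, hence a label
below all of `S`. But the minimum of `T` lies in its first block, which is that of `S`. -/
theorem IsStandardList.eq_nil_of_blocks_eq_append {S T : OrderedSetPartition n}
    {P : List (OrderedSetPartition n)} (h : IsStandardList (S :: P)) (hT : HeadMin T.blocks)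
    {R X : List (Finset (Fin n))} (hR : T.blocks = S.blocks ++ R) (hX : concat P = R ++ X) :
    R = [] := by
  rcases R with - | ⟨B, R⟩
  · rfl
  exfalso
  rcases P with - | ⟨S', P⟩
  · simp at hX
  obtain ⟨A, hA, a, haA, -⟩ := h.headMin S (by simp)
  obtain ⟨A', hA', a', haA', hmin'⟩ := h.headMin S' (by simp)
  obtain ⟨D, hD, d, hdD, hdmin⟩ := hT
  obtain ⟨L, hL⟩ := List.head?_eq_some_iff.1 hA
  obtain ⟨L', hL'⟩ := List.head?_eq_some_iff.1 hA'
  have hDA : A = D := by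
    rw [hR, hL] at hD
    simpa using hD
  have hBA : A' = B := by
    rw [concat_cons, hL'] at hX
    simp at hX
    exact hX.1
  subst hDA hBA
  have h₁ : d ∈ S.support := by
    rw [OrderedSetPartition.support, hL]
    simp [hdD]
  have h₂ : a' < d := lt_of_min_lt ((List.pairwise_cons.1 h.decreasing).1 S' (by simp)) hmin' h₁
  have h₃ : d ≤ a' := hdmin a' (by rw [hR]; simp [haA'])
  exact absurd h₂ (not_lt.2 h₃)

theorem IsStandardList.blocks_ne_nil {S : OrderedSetPartition n}
    {P : List (OrderedSetPartition n)} (h : IsStandardList (S :: P)) : S.blocks ≠ [] := by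
  obtain ⟨A, hA, -⟩ := h.headMin S (by simp)
  intro e
  simp [e] at hA

theorem IsStandardList.concat_injective {P Q : List (OrderedSetPartition n)}
    (hP : IsStandardList P) (hQ : IsStandardList Q) (h : concat P = concat Q) : P = Q := by
  induction P generalizing Q with
  | nil =>
    cases Q with
    | nil => rfl
    | cons T Q => simp [hQ.blocks_ne_nil] at h
  | cons S P ih =>
    cases Q with
    | nil => simp [hP.blocks_ne_nil] at h
    | cons T Q =>
      simp only [concat_cons] at h
      have hST : S.blocks = T.blocks := by
        rcases List.append_eq_append_iff.1 h with ⟨R, h₁, h₂⟩ | ⟨R, h₁, h₂⟩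
        · have := hP.eq_nil_of_blocks_eq_append (hQ.headMin T (by simp)) h₁ h₂
          simpa [this] using h₁.symm
        · have := hQ.eq_nil_of_blocks_eq_append (hP.headMin S (by simp)) h₁ h₂
          simpa [this] using h₁
      rw [hST, List.append_cancel_left_eq] at h
      rw [OrderedSetPartition.ext hST, ih hP.tail hQ.tail h]

theorem exists_isDecreasingConcat (p : FullOrderedSetPartition n) :
    ∃ C : StandardCompositeSetPartition n, IsDecreasingConcat p C.1 := by
  classical
  obtain ⟨P, hP, hc⟩ := exists_isStandardList_concat p.1.blocks (isOrdered_blocks p.1)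
  have hd : P.Pairwise fun S T => Disjoint S.support T.support :=
    isOrdered_concat.1 (hc ▸ isOrdered_blocks p.1)
  have hnd : P.Nodup := hP.decreasing.imp fun h e => by simp [e] at h
  refine ⟨⟨⟨P.toFinset, ?_, ?_, ?_⟩, ?_⟩, P, hnd, by simp, hP.decreasing, hc.symm⟩
  · intro S hS
    obtain ⟨B, hB, a, ha, -⟩ := hP.headMin S (by simpa using hS)
    exact ⟨a, mem_unionOf.2 ⟨B, List.mem_of_mem_head? hB, ha⟩⟩
  · intro S hS T hT hST
    have : Std.Symm fun S T : OrderedSetPartition n => Disjoint S.support T.support :=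
      ⟨fun _ _ h => h.symm⟩
    exact hd.forall (by simpa using hS) (by simpa using hT) hST
  · intro i
    have : i ∈ unionOf (concat P) := by rw [hc, unionOf_blocks]; simp
    simpa using mem_unionOf_concat.1 this
  · intro S hS
    exact hP.headMin S (by simpa using hS)

theorem StandardCompositeSetPartition.exists_isDecreasingConcat
    (C : StandardCompositeSetPartition n) :
    ∃ p : FullOrderedSetPartition n, IsDecreasingConcat p C.1 := by
  classical
  let r : OrderedSetPartition n → OrderedSetPartition n → Prop :=
    fun S T => T.support.min ≤ S.support.min
  have : Std.Total r := ⟨fun S T => le_total _ _⟩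
  have : IsTrans _ r := ⟨fun S T U h₁ h₂ => le_trans h₂ h₁⟩
  let L := C.1.parts.toList.insertionSort r
  have hperm : L.Perm C.1.parts.toList := List.perm_insertionSort _ _
  have hmem : ∀ S, S ∈ L ↔ S ∈ C.1.parts := fun S => by simp [hperm.mem_iff]
  have hnd : L.Nodup := hperm.nodup_iff.2 C.1.parts.nodup_toList
  have hdis : L.Pairwise fun S T => Disjoint S.support T.support :=
    hnd.imp_of_mem fun hS hT hST => C.1.disjoint ((hmem _).1 hS) ((hmem _).1 hT) hST
  have hsort : L.Pairwise r := List.pairwise_insertionSort r _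
  have hdec : L.Pairwise fun S T => T.support.min < S.support.min := by
    refine (hsort.and hdis).imp_of_mem fun {S T} hS _ h => lt_of_le_of_ne h.1 fun e => ?_
    obtain ⟨a, ha⟩ := Finset.min_of_nonempty (C.1.nonempty S ((hmem S).1 hS))
    exact Finset.disjoint_left.1 h.2 (Finset.mem_of_min ha) (Finset.mem_of_min (e.trans ha))
  have ho := isOrdered_concat.2 hdis
  refine ⟨⟨⟨concat L, ho.nonempty, ho.disjoint⟩, ?_⟩, L, hnd, hmem, hdec, rfl⟩
  change unionOf (concat L) = _
  ext i
  simpa [mem_unionOf_concat, hmem] using C.1.cover i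

theorem IsDecreasingConcat.left_unique {p q : FullOrderedSetPartition n}
    {C : CompositeSetPartition n} (hp : IsDecreasingConcat p C) (hq : IsDecreasingConcat q C) :
    p = q := by
  obtain ⟨L, hnd, hL, hd, hb⟩ := hp
  obtain ⟨M, hnd', hM, hd', hb'⟩ := hq
  have hperm : L.Perm M := (List.perm_ext_iff_of_nodup hnd hnd').2 fun S => by rw [hL, hM]
  have : L = M := hperm.eq_of_pairwise
    (fun S T _ _ h₁ h₂ => absurd h₁ (lt_asymm h₂)) hd hd'
  subst this
  exact FullOrderedSetPartition.eq_of_blocks (hb.trans hb'.symm)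

theorem IsDecreasingConcat.right_unique {p : FullOrderedSetPartition n}
    {C D : StandardCompositeSetPartition n} (hC : IsDecreasingConcat p C.1)
    (hD : IsDecreasingConcat p D.1) : C = D := by
  obtain ⟨L, -, hL, hd, hb⟩ := hC
  obtain ⟨M, -, hM, hd', hb'⟩ := hD
  have : L = M := (CompositeSetPartition.isStandardList C.2 hL hd).concat_injective
    (CompositeSetPartition.isStandardList D.2 hM hd') (hb.symm.trans hb')
  subst this
  refine Subtype.ext (CompositeSetPartition.ext ?_)
  ext S
  rw [← hL, ← hM]

theorem exists_equiv_isDecreasingConcat (n : ℕ) :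
    ∃ U : FullOrderedSetPartition n ≃ StandardCompositeSetPartition n,
      ∀ p, IsDecreasingConcat p (U p).1 := by
  choose f hf using exists_isDecreasingConcat (n := n)
  refine ⟨Equiv.ofBijective f ⟨fun p q h => ?_, fun C => ?_⟩, hf⟩
  · exact (hf p).left_unique (h ▸ hf q)
  · obtain ⟨p, hp⟩ := C.exists_isDecreasingConcat
    exact ⟨p, (hf p).right_unique hp⟩

end Bijection

/-! ### From unitriangularity to a basis -/

/-- A family that is unitriangular over a basis, with respect to a well-founded relation, spans the
whole module. -/
theorem top_le_span_of_unitriangular {ι R M : Type*} [Ring R] [AddCommGroup M] [Module R M]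
    (b : Module.Basis ι R M) (v : ι → M) (r : ι → ι → Prop) (hr : WellFounded r)
    (h : ∀ i, v i - b i ∈ Submodule.span R (b '' {j | r j i})) :
    ⊤ ≤ Submodule.span R (Set.range v) := by
  have key : ∀ i, b i ∈ Submodule.span R (Set.range v) := by
    intro i
    induction i using hr.induction with
    | _ i ih =>
      have h₁ : Submodule.span R (b '' {j | r j i}) ≤ Submodule.span R (Set.range v) := by
        rw [Submodule.span_le]
        rintro _ ⟨j, hj, rfl⟩
        exact ih j hj
      have := Submodule.sub_mem _ (Submodule.subset_span (Set.mem_range_self i)) (h₁ (h i))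
      rwa [sub_sub_cancel] at this
  rw [← b.span_eq, Submodule.span_le]
  rintro _ ⟨i, rfl⟩
  exact key i

theorem wellFounded_lexLT (n : ℕ) : WellFounded (LexLT (n := n)) := by
  have : IsTrans (FullOrderedSetPartition n) LexLT := ⟨fun _ _ _ h₁ h₂ => lt_trans h₁ h₂⟩
  have : Std.Irrefl (LexLT (n := n)) := ⟨fun _ => lt_irrefl _⟩
  exact Finite.wellFounded_of_trans_of_irrefl _

end Plates

end

theorem theorem4p6 (n : ℕ) (hn : 1 ≤ n) :
    ∃ (B : Module.Basis (Plates.FullOrderedSetPartition n) ℂ (Plates.plateSpace n))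
      (K : Module.Basis (Plates.StandardCompositeSetPartition n) ℂ (Plates.plateSpace n)),
      (∀ p, (B p : Plates.V0 n → ℂ) = Plates.charFn p.1.plate) ∧
      (∀ C, (K C : Plates.V0 n → ℂ) = C.1.product) ∧
      ∃ U : Plates.FullOrderedSetPartition n ≃ Plates.StandardCompositeSetPartition n,
        (∀ p, Plates.IsDecreasingConcat p (U p).1) ∧
        (∀ p, B.repr (K (U p)) p = 1) ∧
        (∀ p q, B.repr (K (U p)) q ≠ 0 → q = p ∨ Plates.LexLT q p) := by
  classical
  obtain ⟨U, hU⟩ := Plates.exists_equiv_isDecreasingConcat n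
  let B : Module.Basis (Plates.FullOrderedSetPartition n) ℂ (Plates.plateSpace n) :=
    Module.Basis.span (Plates.linearIndependent_charFn_plate (n := n))
  have hB : ∀ p, (B p : Plates.V0 n → ℂ) = Plates.charFn p.1.plate := fun p =>
    Module.Basis.coe_span_apply _ p
  have hsub := fun p => Plates.product_sub_charFn_plate_mem_span (hU p)
  have hmem : ∀ C : Plates.StandardCompositeSetPartition n, C.1.product ∈ Plates.plateSpace n := by
    intro C
    obtain ⟨p, rfl⟩ := U.surjective C
    have h₁ := Submodule.span_mono (Set.image_subset_range _ _) (hsub p)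
    have := Submodule.add_mem _ h₁ (Submodule.subset_span (Set.mem_range_self p))
    rwa [sub_add_cancel] at this
  let v : Plates.FullOrderedSetPartition n → Plates.plateSpace n := fun p => ⟨_, hmem (U p)⟩
  have hv : ∀ p, v p - B p ∈ Submodule.span ℂ (B '' {q | Plates.LexLT q p}) := by
    intro p
    rw [← SetLike.mem_coe, ← (Plates.plateSpace n).subtype_injective.mem_set_image,
      ← Submodule.map_coe, SetLike.mem_coe, Submodule.map_span, ← Set.image_comp]
    convert hsub p using 1
    · simp [hB]
    · rw [Submodule.subtype_apply, Submodule.coe_sub, hB]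
  have := Fintype.ofFinite (Plates.FullOrderedSetPartition n)
  -- A spanning family with as many members as the dimension is a basis; no separate independence
  -- argument is needed.
  let K' := basisOfTopLeSpanOfCardEqFinrank v
    (Plates.top_le_span_of_unitriangular B v _ (Plates.wellFounded_lexLT n) hv)
    (Module.finrank_eq_card_basis B).symm
  have hK : ∀ p, K'.reindex U (U p) = v p := by
    intro p
    simp [K']
  have hrepr : ∀ p q, B.repr (v p - B p) q ≠ 0 → Plates.LexLT q p := fun p q hq =>
    B.repr_support_subset_of_mem_span _ (hv p) (Finsupp.mem_support_iff.2 hq)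
  refine ⟨B, K'.reindex U, hB, fun C => ?_, U, hU, fun p => ?_, fun p q hq => ?_⟩
  · obtain ⟨p, rfl⟩ := U.surjective C
    rw [hK]
  · have : B.repr (v p - B p) p = 0 := by
      by_contra h
      exact lt_irrefl _ (hrepr p p h)
    rw [hK, ← sub_eq_zero]
    simpa using this
  · by_cases hqp : q = p
    · exact Or.inl hqp
    · refine Or.inr (hrepr p q ?_)
      rw [hK] at hq
      simpa [Finsupp.single_apply, Ne.symm hqp] using hq
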